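/- Let $\mathbb F$ be a field. A (right) Leibniz algebra over $\mathbb F$ is a vector space $\mathfrak g$ with a bilinear bracket satisfying $[x,[y,z]]=[[x,y],z]-[[x,z],y]$; ideals are two-sided, $\mathfrak g^2$ is the span of all brackets, $\mathfrak g^{ab}=\mathfrak g/\mathfrak g^2$, and $\mathfrak g$ is nilpotent if its lower central series $\mathfrak g^{1}=\mathfrak g$, $\mathfrak g^{k+1}=[\mathfrak g^{k},\mathfrak g]$ reaches $0$. Let $CL_n(\mathfrak g)=\mathfrak g^{\otimes n}$ with boundary $$\partial_n(x_1\otimes\cdots\otimes x_n)=\sum_{1\le i<j\le n}(-1)^j\,x_1\otimes\cdots\otimes[x_i,x_j]\otimes\cdots\otimes\widehat{x_j}\otimes\cdots\otimes x_n ,$$ where $[x_i,x_j]$ stands in position $i$. For an ideal $\mathfrak n$ of $\mathfrak g$ let $\pi:CL_*(\mathfrak g)\to CL_*(\mathfrak g/\mathfrak n)$ be induced by the projection, and let $M_*$ be its mapping cone, $M_n=CL_{n-1}(\mathfrak g)\oplus CL_n(\mathfrak g/\mathfrak n)$, $\delta_n(a,b)=(-\partial_{n-1} a,\ \bar\partial_n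 b+\pi(a))$, where $\bar\partial$ is the boundary of $CL_*(\mathfrak g/\mathfrak n)$. The second relative homology is $HL_2(\mathfrak g,\mathfrak n)=H_3(M_*)=\ker\delta_3/\operatorname{im}\delta_4$. Let $J_2$ and $H_1$ be the three-dimensional Leibniz algebras with basis $x,y,z$ whose only non-zero brackets of basis vectors are $[x,y]=z$ for $J_2$, and $[x,y]=z=-[y,x]$ for $H_1$. Then: (i) If $\mathfrak a(q)$ is an abelian Leibniz algebra (zero bracket) of finite dimension $q$ and $\mathfrak n$ is an $n$-dimensional ideal of $\mathfrak a(q)$, then $\dim HL_2(\mathfrak a(q),\mathfrak n)=n(2q-n)$. (ii) If $\mathfrak g$ is a finite dimensional nilpotent Leibniz algebra with $\dim\mathfrak g^2=1$, then $\dim HL_2(\mathfrak g,\mathfrak g^2)=2\dim\mathfrak g^{ab}$. (iii) For every non-zero ideal $\mathfrak n$ of $J_2$, $\dim HL_2(J_2,\mathfrak n)=3$ if $\dim\mathfrak n=2$, and $\dim HL_2(J_2,\mathfrak n)=4$ otherwise. For every non-zero ideal $\mathfrak n$ of $H_1$, $\dim HL_2(H_1,\mathfrak n)=5$ if $\mathfrak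 n=H_1$, and $\dim HL_2(H_1,\mathfrak n)=4$ otherwise. -/

import Mathlib

open scoped TensorProduct

/-- A right Leibniz algebra over a field `F`: a vector space with a bilinear bracket satisfying
`[x, [y, z]] = [[x, y], z] - [[x, z], y]`. -/
class LeibnizAlgebra (F L : Type*) [Field F] [AddCommGroup L] [Module F L] where
  bracket : L →ₗ[F] L →ₗ[F] L
  leibniz : ∀ x y z : L,
    bracket x (bracket y z) = bracket (bracket x y) z - bracket (bracket x z) y

namespace LeibnizAlgebra

section Basic

variable (F L : Type*) [Field F] [AddCommGroup L] [Module F L] [LeibnizAlgebra F L]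

/-- The bracket vanishes identically. -/
def IsAbelian : Prop := ∀ x y : L, bracket (F := F) x y = 0

/-- The lower central series `L, [L, L], [[L, L], L], …`. -/
def lowerCentral : ℕ → Submodule F L
  | 0 => ⊤
  | k + 1 => Submodule.span F
      {w | ∃ x ∈ lowerCentral k, ∃ y : L, w = bracket (F := F) x y}

def IsNilpotent : Prop := ∃ k, lowerCentral F L k = ⊥

end Basic

end LeibnizAlgebra

open LeibnizAlgebra in
/-- A (two-sided) ideal of a Leibniz algebra. -/
structure LeibnizIdeal (F L : Type*) [Field F] [AddCommGroup L] [Module F L]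
    [LeibnizAlgebra F L] extends Submodule F L where
  bracket_left_mem : ∀ (x : L) {y : L}, y ∈ toSubmodule → bracket (F := F) x y ∈ toSubmodule
  bracket_right_mem : ∀ {x : L} (y : L), x ∈ toSubmodule → bracket (F := F) x y ∈ toSubmodule

namespace LeibnizAlgebra

section Constructions

variable {F L : Type*} [Field F] [AddCommGroup L] [Module F L] [LeibnizAlgebra F L]

variable (F L) in
/-- The derived ideal `L²`, the linear span of all brackets. -/
def derivedIdeal : LeibnizIdeal F L where
  toSubmodule := Submodule.span F {w | ∃ x y : L, w = bracket (F := F) x y}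
  bracket_left_mem x y _ := Submodule.subset_span ⟨x, y, rfl⟩
  bracket_right_mem {x} y _ := Submodule.subset_span ⟨x, y, rfl⟩

end Constructions

end LeibnizAlgebra

section Quotient

open LeibnizAlgebra

variable {F L : Type*} [Field F] [AddCommGroup L] [Module F L] [LeibnizAlgebra F L]

/-- The quotient `L / N` of a Leibniz algebra by an ideal. -/
def LeibnizIdeal.Quotient (N : LeibnizIdeal F L) : Type _ := L ⧸ N.toSubmodule

instance (N : LeibnizIdeal F L) : AddCommGroup N.Quotient :=
  inferInstanceAs (AddCommGroup (L ⧸ N.toSubmodule))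

instance (N : LeibnizIdeal F L) : Module F N.Quotient :=
  inferInstanceAs (Module F (L ⧸ N.toSubmodule))

/-- The canonical projection `L → L / N`. -/
def LeibnizIdeal.proj (N : LeibnizIdeal F L) : L →ₗ[F] N.Quotient := N.toSubmodule.mkQ

theorem LeibnizIdeal.proj_surjective (N : LeibnizIdeal F L) : Function.Surjective N.proj :=
  N.toSubmodule.mkQ_surjective

/-- The bracket `[x + N, y + N] = [x, y] + N` of the quotient algebra. -/
def LeibnizIdeal.quotientBracketAux (N : LeibnizIdeal F L) :
    (L ⧸ N.toSubmodule) →ₗ[F] (L ⧸ N.toSubmodule) →ₗ[F] (L ⧸ N.toSubmodule) :=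
  N.toSubmodule.liftQ
    (LinearMap.mk₂ F
      (fun (x : L) (v : L ⧸ N.toSubmodule) =>
        N.toSubmodule.mapQ N.toSubmodule (bracket (F := F) x)
          (fun _ hy => N.bracket_left_mem x hy) v)
      (by
        intro x x' v
        induction v using Submodule.Quotient.induction_on with
        | H y => simp)
      (by
        intro c x v
        induction v using Submodule.Quotient.induction_on with
        | H y => simp)
      (by intros; simp)
      (by intros; simp))
    (by
      intro x hx
      rw [LinearMap.mem_ker]
      ext y
      simpa using N.bracket_right_mem y hx)

/-- The same bracket, on the type `N.Quotient`. -/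
def LeibnizIdeal.quotientBracket (N : LeibnizIdeal F L) :
    N.Quotient →ₗ[F] N.Quotient →ₗ[F] N.Quotient := N.quotientBracketAux

theorem LeibnizIdeal.quotientBracket_proj (N : LeibnizIdeal F L) (x y : L) :
    N.quotientBracket (N.proj x) (N.proj y) = N.proj (bracket (F := F) x y) := rfl

instance (N : LeibnizIdeal F L) : LeibnizAlgebra F N.Quotient where
  bracket := N.quotientBracket
  leibniz u v w := by
    obtain ⟨x, rfl⟩ := N.proj_surjective u
    obtain ⟨y, rfl⟩ := N.proj_surjective v
    obtain ⟨z, rfl⟩ := N.proj_surjective w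
    simp only [LeibnizIdeal.quotientBracket_proj, ← map_sub, leibniz]

end Quotient

namespace LeibnizAlgebra

noncomputable section Homology

variable (F L : Type*) [Field F] [AddCommGroup L] [Module F L] [LeibnizAlgebra F L]

/-- The chains `CL_n(L) = L^{⊗ n}` (with `CL_0(L) = F`). -/
abbrev Chains (n : ℕ) : Type _ := ⨂[F] _ : Fin n, L

variable {L} in
/-- The family obtained from `(x_0, …, x_n)` by replacing `x_i` with `[x_i, x_j]` and omitting
`x_j`. -/
def contract {n : ℕ} (i j : Fin (n + 1)) (x : Fin (n + 1) → L) : Fin n → L :=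
  fun k => if j.succAbove k = i then bracket (F := F) (x i) (x j) else x (j.succAbove k)

variable {L} in
theorem exists_contract_update {n : ℕ} {i j : Fin (n + 1)} (hij : i < j)
    (x : Fin (n + 1) → L) (m : Fin (n + 1)) :
    ∃ (y : Fin n → L) (k : Fin n) (f : L →ₗ[F] L), ∀ c : L,
      contract F i j (Function.update x m c) = Function.update y k (f c) := by
  by_cases hmj : m = j
  · subst hmj
    obtain ⟨k, rfl⟩ := Fin.exists_succAbove_eq hij.ne
    refine ⟨fun l => x (m.succAbove l), k, bracket (F := F) (x (m.succAbove k)), fun c => ?_⟩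
    ext l
    by_cases hl : l = k
    · subst hl; simp [contract]
    · simp [contract, hl]
  · obtain ⟨k, rfl⟩ := Fin.exists_succAbove_eq hmj
    by_cases hki : j.succAbove k = i
    · subst hki
      refine ⟨fun l => x (j.succAbove l), k, (bracket (F := F) (L := L)).flip (x j), fun c => ?_⟩
      ext l
      by_cases hl : l = k
      · subst hl; simp [contract]
      · simp [contract, hl]
    · refine ⟨contract F i j x, k, LinearMap.id, fun c => ?_⟩
      ext l
      by_cases hl : l = k
      · subst hl; simp [contract, hki]
      · simp [contract, hl, Function.update_of_ne (Ne.symm hki)]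

variable {L} in
/-- For `i < j`, the multilinear map sending `(x_0, …, x_n)` to the pure tensor obtained from
`x_0 ⊗ ⋯ ⊗ x_n` by replacing `x_i` with `[x_i, x_j]` and omitting `x_j`. -/
def contractMap {n : ℕ} (i j : Fin (n + 1)) (hij : i < j) :
    MultilinearMap F (fun _ : Fin (n + 1) => L) (Chains F L n) where
  toFun x := PiTensorProduct.tprod F (contract F i j x)
  map_update_add' {inst} x m a b := by
    rw [Subsingleton.elim inst (instDecidableEqFin (n + 1))]
    obtain ⟨y, k, f, h⟩ := exists_contract_update F hij x m
    simp only [h, map_add, MultilinearMap.map_update_add]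
  map_update_smul' {inst} x m c a := by
    rw [Subsingleton.elim inst (instDecidableEqFin (n + 1))]
    obtain ⟨y, k, f, h⟩ := exists_contract_update F hij x m
    simp only [h, map_smul, MultilinearMap.map_update_smul]

/-- The Loday boundary `∂_{n+1} : CL_{n+1}(L) → CL_n(L)`,
`∂(x_1 ⊗ ⋯ ⊗ x_{n+1}) = ∑_{i < j} (-1)^j x_1 ⊗ ⋯ ⊗ [x_i, x_j] ⊗ ⋯ ⊗ x̂_j ⊗ ⋯ ⊗ x_{n+1}`.
Positions are numbered from `0` in the code, whence the exponent `j + 1`. -/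
def boundary (n : ℕ) : Chains F L (n + 1) →ₗ[F] Chains F L n :=
  ∑ p : {p : Fin (n + 1) × Fin (n + 1) // p.1 < p.2},
    (-1 : F) ^ ((p.1.2 : ℕ) + 1) • PiTensorProduct.lift (contractMap F p.1.1 p.1.2 p.2)

theorem boundary_tprod (n : ℕ) (x : Fin (n + 1) → L) :
    boundary F L n (PiTensorProduct.tprod F x) =
      ∑ p : {p : Fin (n + 1) × Fin (n + 1) // p.1 < p.2},
        (-1 : F) ^ ((p.1.2 : ℕ) + 1) •
          PiTensorProduct.tprod F (contract F p.1.1 p.1.2 x) := by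
  simp [boundary, contractMap]

variable {F L}

/-- The map `CL_n(L) → CL_n(L/N)` induced by the projection `L → L/N`. -/
def chainsProj (N : LeibnizIdeal F L) (n : ℕ) :
    Chains F L n →ₗ[F] Chains F N.Quotient n :=
  PiTensorProduct.map (fun _ => N.proj)

/-- The differential `δ_{n+2} : M_{n+2} → M_{n+1}` of the mapping cone of
`CL_*(L) → CL_*(L/N)`, where `M_k = CL_{k-1}(L) ⊕ CL_k(L/N)` and
`δ(a, b) = (-∂ a, ∂ b + π a)`. -/
def coneBoundary (N : LeibnizIdeal F L) (n : ℕ) :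
    (Chains F L (n + 1) × Chains F N.Quotient (n + 2)) →ₗ[F]
      (Chains F L n × Chains F N.Quotient (n + 1)) :=
  LinearMap.prod
    (-(boundary F L n ∘ₗ LinearMap.fst F _ _))
    (boundary F N.Quotient (n + 1) ∘ₗ LinearMap.snd F _ _
      + chainsProj N (n + 1) ∘ₗ LinearMap.fst F _ _)

/-- The second relative Leibniz homology `HL_2(L, N) = H_3(M) = ker δ_3 / im δ_4`. -/
abbrev HL₂ (N : LeibnizIdeal F L) : Type _ :=
  LinearMap.ker (coneBoundary N 1) ⧸
    (LinearMap.range (coneBoundary N 2)).submoduleOf (LinearMap.ker (coneBoundary N 1))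

end Homology

end LeibnizAlgebra

/-- The space underlying `J₂ = ⟨x, y, z | [x, y] = z⟩`, in coordinates with respect to the basis
`x, y, z`; all brackets of basis vectors other than `[x, y]` are zero. -/
def J₂ (F : Type*) : Type _ := Fin 3 → F

/-- The space underlying `H₁ = ⟨x, y, z | [x, y] = z = -[y, x]⟩`, in coordinates with respect to
the basis `x, y, z`; all other brackets of basis vectors are zero. -/
def H₁ (F : Type*) : Type _ := Fin 3 → F

section Examples

variable {F : Type*} [Field F]

instance : AddCommGroup (J₂ F) := inferInstanceAs (AddCommGroup (Fin 3 → F))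
instance : Module F (J₂ F) := inferInstanceAs (Module F (Fin 3 → F))
instance : AddCommGroup (H₁ F) := inferInstanceAs (AddCommGroup (Fin 3 → F))
instance : Module F (H₁ F) := inferInstanceAs (Module F (Fin 3 → F))

instance : LeibnizAlgebra F (J₂ F) where
  bracket := (LinearMap.mk₂ F (fun u v : Fin 3 → F => ![0, 0, u 0 * v 1])
    (by intros; ext i; fin_cases i <;> simp [add_mul])
    (by intros; ext i; fin_cases i <;> simp [mul_assoc])
    (by intros; ext i; fin_cases i <;> simp [mul_add])
    (by intros; ext i; fin_cases i <;> simp [mul_left_comm]) :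
      (Fin 3 → F) →ₗ[F] (Fin 3 → F) →ₗ[F] (Fin 3 → F))
  leibniz (u v w : Fin 3 → F) := by
    change ![0, 0, u 0 * (![0, 0, v 0 * w 1] : Fin 3 → F) 1]
      = ![0, 0, (![0, 0, u 0 * v 1] : Fin 3 → F) 0 * w 1]
        - (![0, 0, (![0, 0, u 0 * w 1] : Fin 3 → F) 0 * v 1] : Fin 3 → F)
    ext i; fin_cases i <;> simp

instance : LeibnizAlgebra F (H₁ F) where
  bracket := (LinearMap.mk₂ F (fun u v : Fin 3 → F => ![0, 0, u 0 * v 1 - u 1 * v 0])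
    (by intros; ext i; fin_cases i <;> simp; ring)
    (by intros; ext i; fin_cases i <;> simp; ring)
    (by intros; ext i; fin_cases i <;> simp; ring)
    (by intros; ext i; fin_cases i <;> simp; ring) :
      (Fin 3 → F) →ₗ[F] (Fin 3 → F) →ₗ[F] (Fin 3 → F))
  leibniz (u v w : Fin 3 → F) := by
    change ![0, 0, u 0 * (![0, 0, v 0 * w 1 - v 1 * w 0] : Fin 3 → F) 1
          - u 1 * (![0, 0, v 0 * w 1 - v 1 * w 0] : Fin 3 → F) 0]
      = ![0, 0, (![0, 0, u 0 * v 1 - u 1 * v 0] : Fin 3 → F) 0 * w 1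
          - (![0, 0, u 0 * v 1 - u 1 * v 0] : Fin 3 → F) 1 * w 0]
        - (![0, 0, (![0, 0, u 0 * w 1 - u 1 * w 0] : Fin 3 → F) 0 * v 1
          - (![0, 0, u 0 * w 1 - u 1 * w 0] : Fin 3 → F) 1 * v 0] : Fin 3 → F)
    ext i; fin_cases i <;> simp

end Examples

/-! The projection `CL_*(L) → CL_*(L/N)` is onto over a field, so its cone is, up to a shift,
quasi-isomorphic to its kernel `K_*`, and `HL₂ N` is `H_2(K_*)` (`relCyclesToHL₂_surjective`,
`ker_relCyclesToHL₂`). Rank-nullity then gives `dim HL₂ N = dim K_2 - dim ∂K_2 - dim ∂K_3` with `dim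
K_2 = (dim L)² - (dim L/N)²`. As `K_n` is spanned by the pure tensors with an entry in `N`
(`ker_chainsProj`), both images can be computed by hand.

For abelian `L` both vanish. If `N = Fz` is central and contains the nonzero derived algebra, then
`∂K_2 = 0` and `∂K_3` is the line of `z ⊗ z`, so the dimension is `(m+1)² - m² - 1 = 2m` with `m =
dim L/N`; nilpotency puts (ii) in this case.

In `J₂` and `H₁` a nonzero ideal is `Fz`, covered by the same count, or has an element outside `Fz`.
In the latter case it contains `z`, `∂K_2` is the line of `z`, and `∂K_3` has dimension 4 for `J₂`
and 3 for `H₁`, whichever the ideal. -/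

namespace LeibnizAlgebra

open Module PiTensorProduct

/-! ### Boundaries in low degrees -/

section Homology

variable (F : Type*) {L : Type*} [Field F] [AddCommGroup L] [Module F L]

theorem update_two_zero {L : Type*} (x y u : L) : Function.update ![x, y] 0 u = ![u, y] := by
  ext i; fin_cases i <;> simp

theorem update_two_one {L : Type*} (x y u : L) : Function.update ![x, y] 1 u = ![x, u] := by
  ext i; fin_cases i <;> simp

/-- The pure tensor `x ⊗ y` in `CL_2(L)`, as a bilinear map. -/
noncomputable def pair : L →ₗ[F] L →ₗ[F] Chains F L 2 :=
  LinearMap.mk₂ F (fun x y => tprod F ![x, y])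
    (fun x x' y => by
      simpa only [update_two_zero] using
        (tprod F (s := fun _ : Fin 2 => L)).map_update_add ![x, y] 0 x x')
    (fun c x y => by
      simpa only [update_two_zero] using
        (tprod F (s := fun _ : Fin 2 => L)).map_update_smul ![x, y] 0 c x)
    (fun x y y' => by
      simpa only [update_two_one] using
        (tprod F (s := fun _ : Fin 2 => L)).map_update_add ![x, y] 1 y y')
    (fun c x y => by
      simpa only [update_two_one] using
        (tprod F (s := fun _ : Fin 2 => L)).map_update_smul ![x, y] 1 c y)

theorem tprod_two (x y : L) : tprod F ![x, y] = pair F x y := rfl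

/-- Puts the sum defining `boundary` in a form that `Fin.sum_univ_succ` expands. -/
theorem sum_pairs_lt {M : Type*} [AddCommGroup M] {n : ℕ} (f : Fin n → Fin n → M) :
    ∑ p : {p : Fin n × Fin n // p.1 < p.2}, f p.1.1 p.1.2 =
      ∑ i, ∑ j, if i < j then f i j else 0 := by
  rw [← Fintype.sum_prod_type' (f := fun i j => if i < j then f i j else 0),
    ← Finset.sum_filter]
  exact Finset.sum_subtype (F := inferInstance) _ (by simp) (fun p : Fin n × Fin n => f p.1 p.2) |>.symm

theorem finrank_chains [FiniteDimensional F L] (n : ℕ) : finrank F (Chains F L n) = finrank F L ^ n := by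
  rw [finrank_eq_card_basis (Basis.piTensorProduct fun _ : Fin n => finBasis F L)]
  simp

variable [LeibnizAlgebra F L]

theorem boundary_two (x y : L) :
    boundary F L 1 (tprod F ![x, y]) = tprod F ![bracket (F := F) x y] := by
  rw [boundary_tprod, sum_pairs_lt
    (f := fun i j => (-1 : F) ^ ((j : ℕ) + 1) • tprod F (contract F i j ![x, y]))]
  have h : contract F 0 1 ![x, y] = ![bracket (F := F) x y] := by
    ext k; fin_cases k; simp [contract]
  simp [Fin.sum_univ_succ, h]

theorem boundary_three (x y z : L) :
    boundary F L 2 (tprod F ![x, y, z]) =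
      pair F (bracket (F := F) x y) z - pair F (bracket (F := F) x z) y
        - pair F x (bracket (F := F) y z) := by
  rw [boundary_tprod, sum_pairs_lt
    (f := fun i j => (-1 : F) ^ ((j : ℕ) + 1) • tprod F (contract F i j ![x, y, z]))]
  have h₁ : contract F 0 1 ![x, y, z] = ![bracket (F := F) x y, z] := by
    ext k; fin_cases k <;> simp [contract, Fin.succAbove]
  have h₂ : contract F 0 2 ![x, y, z] = ![bracket (F := F) x z, y] := by
    ext k; fin_cases k <;> simp [contract, Fin.succAbove, Fin.lt_def]
  have h₃ : contract F 1 2 ![x, y, z] = ![x, bracket (F := F) y z] := by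
    ext k; fin_cases k <;> simp [contract, Fin.succAbove, Fin.lt_def]
  simp [Fin.sum_univ_succ, pow_succ, h₁, h₂, h₃, tprod_two]
  abel

theorem boundary_four (x y z w : L) :
    boundary F L 3 (tprod F ![x, y, z, w]) =
      tprod F ![bracket (F := F) x y, z, w] - tprod F ![bracket (F := F) x z, y, w]
        - tprod F ![x, bracket (F := F) y z, w] + tprod F ![bracket (F := F) x w, y, z]
        + tprod F ![x, bracket (F := F) y w, z] + tprod F ![x, y, bracket (F := F) z w] := by
  rw [boundary_tprod, sum_pairs_lt
    (f := fun i j => (-1 : F) ^ ((j : ℕ) + 1) • tprod F (contract F i j ![x, y, z, w]))]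
  have h₁ : contract F 0 1 ![x, y, z, w] = ![bracket (F := F) x y, z, w] := by
    ext k; fin_cases k <;> simp [contract, Fin.succAbove, Fin.lt_def]
  have h₂ : contract F 0 2 ![x, y, z, w] = ![bracket (F := F) x z, y, w] := by
    ext k; fin_cases k <;> simp [contract, Fin.succAbove, Fin.lt_def]
  have h₃ : contract F 1 2 ![x, y, z, w] = ![x, bracket (F := F) y z, w] := by
    ext k; fin_cases k <;> simp [contract, Fin.succAbove, Fin.lt_def]
  have h₄ : contract F 0 3 ![x, y, z, w] = ![bracket (F := F) x w, y, z] := by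
    ext k; fin_cases k <;> simp [contract, Fin.succAbove, Fin.lt_def]
  have h₅ : contract F 1 3 ![x, y, z, w] = ![x, bracket (F := F) y w, z] := by
    ext k; fin_cases k <;> simp [contract, Fin.succAbove, Fin.lt_def]
  have h₆ : contract F 2 3 ![x, y, z, w] = ![x, y, bracket (F := F) z w] := by
    ext k; fin_cases k <;> simp [contract, Fin.succAbove, Fin.lt_def]
  simp [Fin.sum_univ_succ, pow_succ, h₁, h₂, h₃, h₄, h₅, h₆]
  abel

variable (L) in
theorem boundary_comp_boundary_one : boundary F L 1 ∘ₗ boundary F L 2 = 0 := by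
  refine PiTensorProduct.ext (MultilinearMap.ext fun v => ?_)
  obtain ⟨x, y, z, rfl⟩ : ∃ x y z, v = ![x, y, z] :=
    ⟨v 0, v 1, v 2, by ext i; fin_cases i <;> rfl⟩
  -- Identifying `CL_1(L)` with `L` makes linearity in the single entry available to `simp`; the
  -- identity to check is then the Leibniz identity.
  let σ : L →ₗ[F] Chains F L 1 := (subsingletonEquiv (R := F) (s := fun _ : Fin 1 => L) 0).symm
  have hσ (u : L) : tprod F ![u] = σ u := by
    change _ = (subsingletonEquiv (R := F) (s := fun _ : Fin 1 => L) 0).symm u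
    rw [LinearEquiv.eq_symm_apply]
    exact subsingletonEquiv_apply_tprod 0 ![u]
  have h (a b : L) : boundary F L 1 (pair F a b) = σ (bracket (F := F) a b) := by
    rw [← tprod_two, boundary_two, hσ]
  simp [boundary_three, h, leibniz]

variable (L) in
theorem boundary_comp_boundary_two : boundary F L 2 ∘ₗ boundary F L 3 = 0 := by
  refine PiTensorProduct.ext (MultilinearMap.ext fun v => ?_)
  obtain ⟨x, y, z, w, rfl⟩ : ∃ x y z w, v = ![x, y, z, w] :=
    ⟨v 0, v 1, v 2, v 3, by ext i; fin_cases i <;> rfl⟩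
  change boundary F L 2 (boundary F L 3 (tprod F ![x, y, z, w])) = 0
  rw [boundary_four]
  simp only [map_add, map_sub, boundary_three, leibniz, LinearMap.sub_apply]
  abel

variable {F}

/-! ### The kernel of the projection on chains -/

theorem chainsProj_tprod (N : LeibnizIdeal F L) {n : ℕ} (x : Fin n → L) :
    chainsProj N n (tprod F x) = tprod F (fun i => N.proj (x i)) :=
  PiTensorProduct.map_tprod _ _

theorem chainsProj_boundary (N : LeibnizIdeal F L) (n : ℕ) (c : Chains F L (n + 1)) :
    chainsProj N n (boundary F L n c) = boundary F N.Quotient n (chainsProj N (n + 1) c) := by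
  suffices h : chainsProj N n ∘ₗ boundary F L n
      = boundary F N.Quotient n ∘ₗ chainsProj N (n + 1) from LinearMap.congr_fun h c
  refine PiTensorProduct.ext (MultilinearMap.ext fun x => ?_)
  simp only [LinearMap.compMultilinearMap_apply, LinearMap.comp_apply, chainsProj_tprod,
    boundary_tprod, map_sum, map_smul]
  refine Finset.sum_congr rfl fun p _ => ?_
  congr 2
  ext k
  by_cases h : p.1.2.succAbove k = p.1.1
  · simp only [contract, h, if_true]; rfl
  · simp only [contract, h, if_false]

theorem chainsProj_surjective (N : LeibnizIdeal F L) (n : ℕ) :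
    Function.Surjective (chainsProj N n) := by
  obtain ⟨s, hs⟩ := N.proj.exists_rightInverse_of_surjective
    (LinearMap.range_eq_top.2 N.proj_surjective)
  intro c
  refine ⟨PiTensorProduct.map (fun _ => s) c, ?_⟩
  rw [chainsProj, ← LinearMap.comp_apply, ← PiTensorProduct.map_comp, hs,
    PiTensorProduct.map_id, LinearMap.id_apply]

/-- Let `s` be a linear section of the projection. Modulo the span, each entry `x i` may be replaced
by `s (N.proj (x i))`, so the quotient map by the span factors through `chainsProj N n`. -/
theorem ker_chainsProj (N : LeibnizIdeal F L) (n : ℕ) :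
    LinearMap.ker (chainsProj N n) =
      Submodule.span F {t | ∃ x : Fin n → L, (∃ i, x i ∈ N.toSubmodule) ∧ t = tprod F x} := by
  set S := Submodule.span F
    {t | ∃ x : Fin n → L, (∃ i, x i ∈ N.toSubmodule) ∧ t = tprod F x} with hS
  refine le_antisymm ?_ (Submodule.span_le.2 ?_)
  · obtain ⟨s, hs⟩ := N.proj.exists_rightInverse_of_surjective
      (LinearMap.range_eq_top.2 N.proj_surjective)
    have key (x : Fin n → L) :
        S.mkQ (tprod F x) = S.mkQ (tprod F fun i => s (N.proj (x i))) := by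
      -- Expand along `x i = (x i - s (N.proj (x i))) + s (N.proj (x i))`. The first summand lies in
      -- `N`, so only the term indexed by the empty set survives modulo `S`.
      have h := ((S.mkQ.compMultilinearMap (tprod F)).map_add_univ
        (fun i => x i - s (N.proj (x i))) (fun i => s (N.proj (x i))))
      rw [Finset.sum_eq_single ∅] at h
      · simpa [Pi.add_def] using h
      · intro t _ ht
        obtain ⟨i, hi⟩ := Finset.nonempty_iff_ne_empty.2 ht
        refine (Submodule.Quotient.mk_eq_zero _).2 (Submodule.subset_span ⟨_, ⟨i, ?_⟩, rfl⟩)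
        rw [Finset.piecewise_eq_of_mem _ _ _ hi]
        refine (Submodule.Quotient.mk_eq_zero _).1 ?_
        change N.proj _ = 0
        rw [map_sub, ← LinearMap.comp_apply, hs, LinearMap.id_apply, sub_self]
      · simp
    have key' : S.mkQ = S.mkQ ∘ₗ PiTensorProduct.map (fun _ => s) ∘ₗ chainsProj N n := by
      refine PiTensorProduct.ext (MultilinearMap.ext fun x => ?_)
      simpa [chainsProj_tprod] using key x
    intro c hc
    rw [← Submodule.ker_mkQ S, LinearMap.mem_ker, key', LinearMap.comp_apply, LinearMap.comp_apply,
      LinearMap.mem_ker.1 hc, map_zero, map_zero]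
  · rintro _ ⟨x, ⟨i, hi⟩, rfl⟩
    rw [SetLike.mem_coe, LinearMap.mem_ker, chainsProj_tprod]
    exact (PiTensorProduct.tprod F).map_coord_zero i ((Submodule.Quotient.mk_eq_zero _).2 hi)

/-- The cycles of degree `2` of the kernel of `CL_*(L) → CL_*(L/N)`. -/
noncomputable def relCycles (N : LeibnizIdeal F L) : Submodule F (Chains F L 2) :=
  LinearMap.ker (boundary F L 1) ⊓ LinearMap.ker (chainsProj N 2)

/-- The boundaries of degree `2` of the kernel of `CL_*(L) → CL_*(L/N)`. -/
noncomputable def relBoundaries (N : LeibnizIdeal F L) : Submodule F (Chains F L 2) :=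
  (LinearMap.ker (chainsProj N 3)).map (boundary F L 2)

theorem relBoundaries_le (N : LeibnizIdeal F L) : relBoundaries N ≤ relCycles N := by
  rintro _ ⟨c, hc, rfl⟩
  refine ⟨LinearMap.congr_fun (boundary_comp_boundary_one F L) c, ?_⟩
  rw [SetLike.mem_coe, LinearMap.mem_ker, chainsProj_boundary, LinearMap.mem_ker.1 hc, map_zero]

/-! ### The homology of the cone as homology of the kernel -/

theorem coneBoundary_apply (N : LeibnizIdeal F L) (n : ℕ) (a : Chains F L (n + 1))
    (b : Chains F N.Quotient (n + 2)) :
    coneBoundary N n (a, b) =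
      (-boundary F L n a, boundary F N.Quotient (n + 1) b + chainsProj N (n + 1) a) := rfl

/-- `HL₂ N` is the second homology of the kernel of `CL_*(L) → CL_*(L/N)`. -/
noncomputable def relCyclesToHL₂ (N : LeibnizIdeal F L) : relCycles N →ₗ[F] HL₂ N :=
  Submodule.mkQ _ ∘ₗ LinearMap.codRestrict (LinearMap.ker (coneBoundary N 1))
    (LinearMap.inl F _ _ ∘ₗ (relCycles N).subtype) (fun a => by
      have h₁ := LinearMap.mem_ker.1 a.2.1
      have h₂ := LinearMap.mem_ker.1 a.2.2
      simp [coneBoundary_apply, h₁, h₂])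

/-- Lift `b` to a chain `c` of `L`: adding `δ(-c, 0) = (∂c, -b)` moves the cycle `(a, b)` to `(a +
∂c, 0)`. -/
theorem relCyclesToHL₂_surjective (N : LeibnizIdeal F L) :
    Function.Surjective (relCyclesToHL₂ N) := by
  intro h
  obtain ⟨⟨⟨a, b⟩, hab⟩, rfl⟩ := Submodule.mkQ_surjective _ h
  obtain ⟨c, hc⟩ := chainsProj_surjective N 3 b
  have hab' := LinearMap.mem_ker.1 hab
  rw [coneBoundary_apply, Prod.mk_eq_zero, neg_eq_zero] at hab'
  have hz : a + boundary F L 2 c ∈ relCycles N := by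
    refine ⟨?_, ?_⟩
    · have := LinearMap.congr_fun (boundary_comp_boundary_one F L) c
      simp only [LinearMap.comp_apply, LinearMap.zero_apply] at this
      simp [hab'.1, this]
    · rw [SetLike.mem_coe, LinearMap.mem_ker, map_add, chainsProj_boundary, hc, add_comm]
      exact hab'.2
  refine ⟨⟨_, hz⟩, (Submodule.Quotient.eq _).2 ⟨(-c, 0), ?_⟩⟩
  change _ = (a + boundary F L 2 c, (0 : Chains F N.Quotient 3)) - (a, b)
  rw [coneBoundary_apply]
  simp [hc]

/-- If `(a, 0) = δ(c, d)` and `e` lifts `d`, then `-(c + ∂e)` lies in the kernel of the projection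
and, since `∂∂ = 0`, has boundary `a`. -/
theorem ker_relCyclesToHL₂ (N : LeibnizIdeal F L) :
    LinearMap.ker (relCyclesToHL₂ N) = (relBoundaries N).submoduleOf (relCycles N) := by
  ext ⟨a, ha⟩
  have : (⟨a, ha⟩ : relCycles N) ∈ LinearMap.ker (relCyclesToHL₂ N) ↔
      (a, (0 : Chains F N.Quotient 3)) ∈ LinearMap.range (coneBoundary N 2) :=
    Submodule.Quotient.mk_eq_zero _
  rw [this]
  constructor
  · rintro ⟨⟨c, d⟩, h⟩
    obtain ⟨e, rfl⟩ := chainsProj_surjective N 4 d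
    have hd := LinearMap.congr_fun (boundary_comp_boundary_two F L) e
    rw [LinearMap.comp_apply, LinearMap.zero_apply] at hd
    rw [coneBoundary_apply, Prod.mk.injEq] at h
    refine ⟨-(c + boundary F L 3 e), ?_, ?_⟩
    · rw [SetLike.mem_coe, LinearMap.mem_ker, map_neg, map_add, chainsProj_boundary, add_comm,
        neg_eq_zero]
      exact h.2
    · simp [hd, h.1]
  · rintro ⟨c, hc, h⟩
    refine ⟨(-c, 0), ?_⟩
    simp only [Submodule.subtype_apply] at h
    simp [coneBoundary_apply, LinearMap.mem_ker.1 hc, h]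

/-! ### Dimension counts -/

variable [FiniteDimensional F L]

instance (N : LeibnizIdeal F L) : FiniteDimensional F N.Quotient :=
  inferInstanceAs (FiniteDimensional F (L ⧸ N.toSubmodule))

theorem finrank_HL₂_add (N : LeibnizIdeal F L) :
    finrank F (HL₂ N) + finrank F (relBoundaries N) = finrank F (relCycles N) := by
  have h := (relCyclesToHL₂ N).finrank_range_add_finrank_ker
  rw [LinearMap.range_eq_top.2 (relCyclesToHL₂_surjective N), finrank_top,
    ker_relCyclesToHL₂] at h
  rw [← h, (Submodule.submoduleOfEquivOfLe (relBoundaries_le N)).finrank_eq]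

theorem finrank_quotient_add (N : LeibnizIdeal F L) :
    finrank F N.Quotient + finrank F N.toSubmodule = finrank F L :=
  Submodule.finrank_quotient_add_finrank N.toSubmodule

theorem finrank_ker_chainsProj_add (N : LeibnizIdeal F L) (n : ℕ) :
    finrank F N.Quotient ^ n + finrank F (LinearMap.ker (chainsProj N n)) = finrank F L ^ n := by
  have h := (chainsProj N n).finrank_range_add_finrank_ker
  rwa [LinearMap.range_eq_top.2 (chainsProj_surjective N n), finrank_top, finrank_chains,
    finrank_chains] at h

theorem finrank_relCycles_add (N : LeibnizIdeal F L) :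
    finrank F ((LinearMap.ker (chainsProj N 2)).map (boundary F L 1)) + finrank F (relCycles N) =
      finrank F (LinearMap.ker (chainsProj N 2)) := by
  have h := ((boundary F L 1).domRestrict (LinearMap.ker (chainsProj N 2))).finrank_range_add_finrank_ker
  rw [LinearMap.range_domRestrict, LinearMap.ker_domRestrict] at h
  rw [← h, relCycles, inf_comm, ← Submodule.map_comap_subtype]
  congr 1
  exact (Submodule.equivMapOfInjective _ (Submodule.injective_subtype _) _).finrank_eq.symm

end Homology

/-! ### Abelian algebras and central lines -/

section Computation

variable {F L : Type*} [Field F] [AddCommGroup L] [Module F L]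

/-- The linear form `x ⊗ y ↦ f x * g y` on `CL_2(L)`. -/
noncomputable def pairForm (f g : L →ₗ[F] F) : Chains F L 2 →ₗ[F] F :=
  PiTensorProduct.lift ((MultilinearMap.mkPiAlgebra F (Fin 2) F).compLinearMap ![f, g])

theorem pairForm_pair (f g : L →ₗ[F] F) (x y : L) : pairForm f g (pair F x y) = f x * g y := by
  rw [← tprod_two, pairForm, PiTensorProduct.lift.tprod]
  simp

theorem pair_self_ne_zero {x : L} (hx : x ≠ 0) : pair F x x ≠ 0 := by
  obtain ⟨f, hf⟩ := Module.Projective.exists_dual_ne_zero F hx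
  intro h
  have := pairForm_pair f f x x
  rw [h, map_zero] at this
  exact mul_ne_zero hf hf this.symm

theorem tprod_one_ne_zero {x : L} (hx : x ≠ 0) : PiTensorProduct.tprod F ![x] ≠ 0 := by
  intro h
  have := subsingletonEquiv_apply_tprod (R := F) (s := fun _ : Fin 1 => L) 0 ![x]
  rw [h, map_zero] at this
  exact hx this.symm

theorem tprod_one_smul (c : F) (x : L) :
    PiTensorProduct.tprod F ![c • x] = c • PiTensorProduct.tprod F ![x] := by
  apply (subsingletonEquiv (R := F) (s := fun _ : Fin 1 => L) 0).injective
  rw [map_smul, subsingletonEquiv_apply_tprod, subsingletonEquiv_apply_tprod]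
  rfl

theorem tprod_zero_one : PiTensorProduct.tprod F ![(0 : L)] = 0 :=
  (PiTensorProduct.tprod F).map_coord_zero (0 : Fin 1) rfl

theorem eq_span_singleton_of_finrank_eq_one [FiniteDimensional F L] {N : Submodule F L} (hN : finrank F N = 1) {z : L}
    (hz : z ∈ N) (hz₀ : z ≠ 0) : N = Submodule.span F {z} :=
  (Submodule.eq_of_le_of_finrank_eq (Submodule.span_le.2 (by simpa using hz))
    (by rw [finrank_span_singleton hz₀, hN])).symm

theorem eq_coords (b : Basis (Fin 3) F L) (u : L) :
    ∃ u₀ u₁ u₂ : F, u = u₀ • b 0 + u₁ • b 1 + u₂ • b 2 :=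
  ⟨b.repr u 0, b.repr u 1, b.repr u 2, by
    conv_lhs => rw [← b.sum_repr u, Fin.sum_univ_three]⟩

variable [LeibnizAlgebra F L]

theorem boundary_mem_relBoundaries {N : LeibnizIdeal F L} {x y z : L}
    (h : x ∈ N.toSubmodule ∨ y ∈ N.toSubmodule ∨ z ∈ N.toSubmodule) :
    pair F (bracket (F := F) x y) z - pair F (bracket (F := F) x z) y
      - pair F x (bracket (F := F) y z) ∈ relBoundaries N := by
  refine ⟨PiTensorProduct.tprod F ![x, y, z], ?_, boundary_three F x y z⟩
  rw [ker_chainsProj]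
  refine Submodule.subset_span ⟨_, ?_, rfl⟩
  rcases h with h | h | h
  exacts [⟨0, h⟩, ⟨1, h⟩, ⟨2, h⟩]

theorem relBoundaries_le_of_forall {N : LeibnizIdeal F L} {S : Submodule F (Chains F L 2)}
    (h : ∀ x y z : L, (x ∈ N.toSubmodule ∨ y ∈ N.toSubmodule ∨ z ∈ N.toSubmodule) →
      pair F (bracket (F := F) x y) z - pair F (bracket (F := F) x z) y
        - pair F x (bracket (F := F) y z) ∈ S) :
    relBoundaries N ≤ S := by
  rw [relBoundaries, ker_chainsProj, Submodule.map_le_iff_le_comap, Submodule.span_le]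
  rintro _ ⟨v, ⟨i, hi⟩, rfl⟩
  obtain ⟨x, y, z, rfl⟩ : ∃ x y z, v = ![x, y, z] :=
    ⟨v 0, v 1, v 2, by ext i; fin_cases i <;> rfl⟩
  rw [SetLike.mem_coe, Submodule.mem_comap, boundary_three]
  apply h
  fin_cases i
  exacts [Or.inl hi, Or.inr (Or.inl hi), Or.inr (Or.inr hi)]

theorem boundary_mem_map_ker {N : LeibnizIdeal F L} {x y : L}
    (h : x ∈ N.toSubmodule ∨ y ∈ N.toSubmodule) :
    PiTensorProduct.tprod F ![bracket (F := F) x y] ∈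
      (LinearMap.ker (chainsProj N 2)).map (boundary F L 1) := by
  refine ⟨PiTensorProduct.tprod F ![x, y], ?_, boundary_two F x y⟩
  rw [ker_chainsProj]
  refine Submodule.subset_span ⟨_, ?_, rfl⟩
  rcases h with h | h
  exacts [⟨0, h⟩, ⟨1, h⟩]

theorem map_ker_le_of_forall {N : LeibnizIdeal F L} {S : Submodule F (Chains F L 1)}
    (h : ∀ x y : L, (x ∈ N.toSubmodule ∨ y ∈ N.toSubmodule) →
      PiTensorProduct.tprod F ![bracket (F := F) x y] ∈ S) :
    (LinearMap.ker (chainsProj N 2)).map (boundary F L 1) ≤ S := by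
  rw [ker_chainsProj, Submodule.map_le_iff_le_comap, Submodule.span_le]
  rintro _ ⟨v, ⟨i, hi⟩, rfl⟩
  obtain ⟨x, y, rfl⟩ : ∃ x y, v = ![x, y] := ⟨v 0, v 1, by ext i; fin_cases i <;> rfl⟩
  rw [SetLike.mem_coe, Submodule.mem_comap, boundary_two]
  apply h
  fin_cases i
  exacts [Or.inl hi, Or.inr hi]

variable [FiniteDimensional F L]

theorem finrank_HL₂_of_isAbelian (h : IsAbelian F L) (N : LeibnizIdeal F L) :
    finrank F (HL₂ N) + finrank F N.Quotient ^ 2 = finrank F L ^ 2 := by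
  have h₁ : relBoundaries N = ⊥ := le_bot_iff.1 <| relBoundaries_le_of_forall fun x y z _ => by
    simp [h x y, h x z, h y z]
  have h₂ : (LinearMap.ker (chainsProj N 2)).map (boundary F L 1) = ⊥ :=
    le_bot_iff.1 <| map_ker_le_of_forall fun x y _ => by simp [h x y, tprod_zero_one]
  have e₁ := finrank_HL₂_add N
  have e₂ := finrank_relCycles_add N
  have e₃ := finrank_ker_chainsProj_add N 2
  rw [h₁, finrank_bot] at e₁
  rw [h₂, finrank_bot] at e₂
  omega

/-- Centrality kills `∂` on `K_2`. In the boundary of a triple with an entry in `N`, every term that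
has that entry inside a bracket vanishes; the remaining one lies in `N ⊗ N`, a line. -/
theorem finrank_HL₂_of_central_line {N : LeibnizIdeal F L} (hN : finrank F N.toSubmodule = 1)
    (hl : ∀ x ∈ N.toSubmodule, ∀ y, bracket (F := F) x y = 0)
    (hr : ∀ x, ∀ y ∈ N.toSubmodule, bracket (F := F) x y = 0)
    (hb : ∀ x y : L, bracket (F := F) x y ∈ N.toSubmodule)
    (hne : ¬ IsAbelian F L) :
    finrank F (HL₂ N) = 2 * finrank F N.Quotient := by
  obtain ⟨x, y, hxy⟩ : ∃ x y : L, bracket (F := F) x y ≠ 0 := by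
    simpa [IsAbelian] using hne
  set z := bracket (F := F) x y with hz
  have hspan := eq_span_singleton_of_finrank_eq_one hN (hb x y) hxy
  have hmem {u : L} (hu : u ∈ N.toSubmodule) : ∃ c : F, c • z = u := by
    rwa [hspan, Submodule.mem_span_singleton] at hu
  have hzz {u v : L} (hu : u ∈ N.toSubmodule) (hv : v ∈ N.toSubmodule) :
      pair F u v ∈ Submodule.span F {pair F z z} := by
    obtain ⟨a, rfl⟩ := hmem hu
    obtain ⟨b, rfl⟩ := hmem hv
    simpa using Submodule.smul_mem _ _ (Submodule.smul_mem _ _ (Submodule.mem_span_singleton_self _))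
  have h₁ : relBoundaries N = Submodule.span F {pair F z z} := by
    refine le_antisymm (relBoundaries_le_of_forall fun p q r h => ?_)
      (Submodule.span_le.2 ?_)
    · rcases h with h | h | h
      · simpa [hl p h] using hzz h (hb q r)
      · simpa [hl q h, hr p q h] using hzz (hb p r) h
      · simpa [hr _ r h] using hzz (hb p q) h
    · have := boundary_mem_relBoundaries (N := N) (x := x) (y := y) (z := z)
        (Or.inr (Or.inr (hb x y)))
      simpa [hr _ z (hb x y)] using this
  have h₂ : (LinearMap.ker (chainsProj N 2)).map (boundary F L 1) = ⊥ :=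
    le_bot_iff.1 <| map_ker_le_of_forall fun p q h => by
      have : bracket (F := F) p q = 0 := h.elim (fun h => hl p h q) (fun h => hr p q h)
      simp [this, tprod_zero_one]
  have e₁ := finrank_HL₂_add N
  have e₂ := finrank_relCycles_add N
  have e₃ := finrank_ker_chainsProj_add N 2
  have e₄ := finrank_quotient_add N
  rw [h₁, finrank_span_singleton (pair_self_ne_zero hxy)] at e₁
  rw [h₂, finrank_bot] at e₂
  rw [← e₄, hN] at e₃
  have : (finrank F N.Quotient + 1) ^ 2 = finrank F N.Quotient ^ 2 + (2 * finrank F N.Quotient + 1) := by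
    ring
  omega

/-- A nonzero `[x, y]` with `x ∈ L²` would span the line `L²`, so `L²` would lie in every term of
the lower central series. -/
theorem IsNilpotent.bracket_eq_zero (hL : IsNilpotent F L)
    (h1 : finrank F (derivedIdeal F L).toSubmodule = 1) {x : L}
    (hx : x ∈ (derivedIdeal F L).toSubmodule) (y : L) : bracket (F := F) x y = 0 := by
  by_contra hne
  have hspan := eq_span_singleton_of_finrank_eq_one h1
    ((derivedIdeal F L).bracket_right_mem y hx) hne
  have key (k : ℕ) : (derivedIdeal F L).toSubmodule ≤ lowerCentral F L k := by
    induction k with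
    | zero => exact le_top
    | succ k ih =>
      rw [hspan, Submodule.span_le, Set.singleton_subset_iff]
      exact Submodule.subset_span ⟨x, ih hx, y, rfl⟩
  obtain ⟨k, hk⟩ := hL
  have := key k
  rw [hk, le_bot_iff] at this
  rw [this, finrank_bot] at h1
  exact zero_ne_one h1

theorem finrank_HL₂_derivedIdeal (hL : IsNilpotent F L)
    (h1 : finrank F (derivedIdeal F L).toSubmodule = 1) :
    finrank F (HL₂ (derivedIdeal F L)) = 2 * finrank F (derivedIdeal F L).Quotient := by
  refine finrank_HL₂_of_central_line h1 (fun x hx y => hL.bracket_eq_zero h1 hx y) ?_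
    (fun x y => Submodule.subset_span ⟨x, y, rfl⟩) ?_
  · intro x y hy
    refine Submodule.span_induction (p := fun y _ => bracket (F := F) x y = 0) ?_ (map_zero _)
      (fun a b _ _ ha hb => by rw [map_add, ha, hb, add_zero])
      (fun c a _ ha => by rw [map_smul, ha, smul_zero]) hy
    rintro _ ⟨u, v, rfl⟩
    -- The Leibniz identity turns `[L, L²]` into elements of `[L², L]`, already known to vanish.
    rw [leibniz, hL.bracket_eq_zero h1 (Submodule.subset_span ⟨x, u, rfl⟩),
      hL.bracket_eq_zero h1 (Submodule.subset_span ⟨x, v, rfl⟩), sub_zero]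
  · intro h
    have : (derivedIdeal F L).toSubmodule = ⊥ := by
      refine le_bot_iff.1 (Submodule.span_le.2 ?_)
      rintro _ ⟨u, v, rfl⟩
      exact h u v
    rw [this, finrank_bot] at h1
    exact zero_ne_one h1

end Computation

/-! ### Three-dimensional algebras with central `z` -/

section ThreeDimensional

variable {F L : Type*} [Field F] [AddCommGroup L] [Module F L] [LeibnizAlgebra F L]

theorem eq_span_or_exists_coord_ne_zero (b : Basis (Fin 3) F L) {N : LeibnizIdeal F L} (hN : N.toSubmodule ≠ ⊥) :
    N.toSubmodule = Submodule.span F {b 2} ∨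
      ∃ v ∈ N.toSubmodule, b.repr v 0 ≠ 0 ∨ b.repr v 1 ≠ 0 := by
  by_cases h : ∃ v ∈ N.toSubmodule, b.repr v 0 ≠ 0 ∨ b.repr v 1 ≠ 0
  · exact Or.inr h
  · push Not at h
    have hle (v : L) (hv : v ∈ N.toSubmodule) : v = b.repr v 2 • b 2 := by
      conv_lhs => rw [← b.sum_repr v, Fin.sum_univ_three, (h v hv).1, (h v hv).2]
      simp
    refine Or.inl (le_antisymm (fun v hv => ?_) (Submodule.span_le.2 ?_))
    · rw [hle v hv]
      exact Submodule.smul_mem _ _ (Submodule.mem_span_singleton_self _)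
    · obtain ⟨v, hv, hv₀⟩ := Submodule.exists_mem_ne_zero_of_ne_bot hN
      have hc : b.repr v 2 ≠ 0 := by
        intro hc
        apply hv₀
        rw [hle v hv, hc, zero_smul]
      rw [Set.singleton_subset_iff, SetLike.mem_coe, ← Submodule.smul_mem_iff _ hc, ← hle v hv]
      exact hv

/-- In the basis `x, y, z` all brackets are multiples of the central element `z`, and
`[v, y]` and `[x, v]` are `z` times the `x`-coordinate and the `y`-coordinate of `v`. -/
structure IsStandardBasis (b : Basis (Fin 3) F L) : Prop where
  bracket_mem : ∀ u v : L, ∃ c : F, bracket (F := F) u v = c • b 2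
  bracket_y : ∀ v : L, bracket (F := F) v (b 1) = b.repr v 0 • b 2
  bracket_x : ∀ v : L, bracket (F := F) (b 0) v = b.repr v 1 • b 2
  bracket_z_left : ∀ v : L, bracket (F := F) (b 2) v = 0
  bracket_z_right : ∀ v : L, bracket (F := F) v (b 2) = 0

namespace IsStandardBasis

variable {b : Basis (Fin 3) F L} (hb : IsStandardBasis b)
include hb

/-- Bracketing `v` with `y` or `x` yields a nonzero multiple of `z` inside the ideal. -/
theorem z_mem {N : LeibnizIdeal F L} {v : L} (hv : v ∈ N.toSubmodule)
    (h : b.repr v 0 ≠ 0 ∨ b.repr v 1 ≠ 0) : b 2 ∈ N.toSubmodule := by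
  rcases h with h | h
  · have := N.bracket_right_mem (b 1) hv
    rwa [hb.bracket_y, Submodule.smul_mem_iff _ h] at this
  · have := N.bracket_left_mem (b 0) hv
    rwa [hb.bracket_x, Submodule.smul_mem_iff _ h] at this

theorem finrank_HL₂_of_eq_span {N : LeibnizIdeal F L}
    (hN : N.toSubmodule = Submodule.span F {b 2}) : finrank F (HL₂ N) = 4 := by
  have : FiniteDimensional F L := b.finiteDimensional_of_finite
  have h1 : finrank F N.toSubmodule = 1 := by rw [hN, finrank_span_singleton (b.ne_zero 2)]
  have h3 := finrank_quotient_add N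
  rw [h1, finrank_eq_card_basis b, Fintype.card_fin] at h3
  have hmem {u : L} (hu : u ∈ N.toSubmodule) : ∃ c : F, c • b 2 = u := by
    rwa [hN, Submodule.mem_span_singleton] at hu
  rw [finrank_HL₂_of_central_line h1]
  · omega
  · intro u hu v
    obtain ⟨c, rfl⟩ := hmem hu
    simp [hb.bracket_z_left]
  · intro u v hv
    obtain ⟨c, rfl⟩ := hmem hv
    simp [hb.bracket_z_right]
  · intro u v
    obtain ⟨c, hc⟩ := hb.bracket_mem u v
    rw [hN, hc]
    exact Submodule.smul_mem _ _ (Submodule.mem_span_singleton_self _)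
  · intro h
    have := hb.bracket_y (b 0)
    rw [h] at this
    exact b.ne_zero 2 (by simpa using this.symm)

theorem finrank_eq_two_or_three {N : LeibnizIdeal F L} {v : L} (hv : v ∈ N.toSubmodule)
    (h : b.repr v 0 ≠ 0 ∨ b.repr v 1 ≠ 0) :
    finrank F N.toSubmodule = 2 ∨ finrank F N.toSubmodule = 3 := by
  have : FiniteDimensional F L := b.finiteDimensional_of_finite
  have h3 := finrank_quotient_add N
  rw [finrank_eq_card_basis b, Fintype.card_fin] at h3
  have hz := hb.z_mem hv h
  have h0 : finrank F N.toSubmodule ≠ 0 := by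
    rw [Ne, Submodule.finrank_eq_zero]
    rintro hN
    rw [hN] at hz
    exact b.ne_zero 2 hz
  have h1 : finrank F N.toSubmodule ≠ 1 := by
    intro h1
    rw [eq_span_singleton_of_finrank_eq_one h1 hz (b.ne_zero 2),
      Submodule.mem_span_singleton] at hv
    obtain ⟨c, rfl⟩ := hv
    simp at h
  omega

/-- The `1` is the dimension of `∂K_2 = Fz`, reached by `[v, y]` or `[x, v]`; the square is `dim
CL_2(L/N)`. The subtraction is not truncated, as `dim N ≤ 3`. -/
theorem finrank_HL₂_add_relBoundaries {N : LeibnizIdeal F L} {v : L} (hv : v ∈ N.toSubmodule)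
    (h : b.repr v 0 ≠ 0 ∨ b.repr v 1 ≠ 0) :
    finrank F (HL₂ N) + finrank F (relBoundaries N) + 1 + (3 - finrank F N.toSubmodule) ^ 2 = 9 := by
  have : FiniteDimensional F L := b.finiteDimensional_of_finite
  have h₂ : (LinearMap.ker (chainsProj N 2)).map (boundary F L 1) =
      Submodule.span F {PiTensorProduct.tprod F ![b 2]} := by
    refine le_antisymm (map_ker_le_of_forall fun p q _ => ?_) (Submodule.span_le.2 ?_)
    · obtain ⟨c, hc⟩ := hb.bracket_mem p q
      rw [hc, tprod_one_smul]
      exact Submodule.smul_mem _ _ (Submodule.mem_span_singleton_self _)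
    · rw [Set.singleton_subset_iff, SetLike.mem_coe]
      rcases h with h | h
      · have := boundary_mem_map_ker (N := N) (y := b 1) (Or.inl hv)
        rwa [hb.bracket_y, tprod_one_smul, Submodule.smul_mem_iff _ h] at this
      · have := boundary_mem_map_ker (N := N) (x := b 0) (Or.inr hv)
        rwa [hb.bracket_x, tprod_one_smul, Submodule.smul_mem_iff _ h] at this
  have e₁ := finrank_HL₂_add N
  have e₂ := finrank_relCycles_add N
  have e₃ := finrank_ker_chainsProj_add N 2
  have e₄ := finrank_quotient_add N
  rw [h₂, finrank_span_singleton (tprod_one_ne_zero (b.ne_zero 2))] at e₂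
  rw [finrank_eq_card_basis b, Fintype.card_fin] at e₃ e₄
  rw [show 3 - finrank F N.toSubmodule = finrank F N.Quotient by omega]
  omega

theorem pair_z_z_mem {N : LeibnizIdeal F L} (hz : b 2 ∈ N.toSubmodule) :
    pair F (b 2) (b 2) ∈ relBoundaries N := by
  have := boundary_mem_relBoundaries (N := N) (x := b 0) (y := b 1) (Or.inr (Or.inr hz))
  simpa [hb.bracket_y, hb.bracket_z_right] using this

end IsStandardBasis

variable {b : Basis (Fin 3) F L}

theorem isStandardBasis_of_J₂
    (hb : ∀ u v : L, bracket (F := F) u v = (b.repr u 0 * b.repr v 1) • b 2) :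
    IsStandardBasis b where
  bracket_mem u v := ⟨_, hb u v⟩
  bracket_y v := by simp [hb]
  bracket_x v := by simp [hb]
  bracket_z_left v := by simp [hb]
  bracket_z_right v := by simp [hb]

theorem isStandardBasis_of_H₁
    (hb : ∀ u v : L, bracket (F := F) u v = (b.repr u 0 * b.repr v 1 - b.repr u 1 * b.repr v 0) • b 2) :
    IsStandardBasis b where
  bracket_mem u v := ⟨_, hb u v⟩
  bracket_y v := by simp [hb]
  bracket_x v := by simp [hb]
  bracket_z_left v := by simp [hb]
  bracket_z_right v := by simp [hb]

/-- The boundaries are spanned by `z ⊗ x`, `x ⊗ z`, `y ⊗ z`, `z ⊗ z`. The tensor `z ⊗ y` never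
occurs: its coefficient in `∂(p ⊗ q ⊗ r)` is `p₀q₁r₁ - p₀r₁q₁ = 0`. -/
theorem finrank_relBoundaries_of_J₂
    (hb : ∀ u v : L, bracket (F := F) u v = (b.repr u 0 * b.repr v 1) • b 2)
    {N : LeibnizIdeal F L} {v : L} (hv : v ∈ N.toSubmodule)
    (h : b.repr v 0 ≠ 0 ∨ b.repr v 1 ≠ 0) : finrank F (relBoundaries N) = 4 := by
  have hb' := isStandardBasis_of_J₂ hb
  have hzz := hb'.pair_z_z_mem (hb'.z_mem hv h)
  let w : Fin 4 → Chains F L 2 :=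
    ![pair F (b 2) (b 0), pair F (b 0) (b 2), pair F (b 1) (b 2), pair F (b 2) (b 2)]
  have hw : LinearIndependent F w := by
    rw [Fintype.linearIndependent_iff]
    intro g hg
    -- Products of coordinate forms read off the coefficients of the relation.
    have key (i j : Fin 3) := congrArg (pairForm (b.coord i) (b.coord j)) hg
    simp [w, Fin.sum_univ_four, pairForm_pair, Finsupp.single_apply] at key
    have h₀ := key 2 0
    have h₁ := key 0 2
    have h₂ := key 1 2
    have h₃ := key 2 2
    simp at h₀ h₁ h₂ h₃
    intro i
    fin_cases i <;> assumption
  have hS : relBoundaries N = Submodule.span F (Set.range w) := by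
    have hwi (i : Fin 4) : w i ∈ Submodule.span F (Set.range w) :=
      Submodule.subset_span ⟨i, rfl⟩
    refine le_antisymm (relBoundaries_le_of_forall fun p q r _ => ?_) (Submodule.span_le.2 ?_)
    · obtain ⟨p₀, p₁, p₂, rfl⟩ := eq_coords b p
      obtain ⟨q₀, q₁, q₂, rfl⟩ := eq_coords b q
      obtain ⟨r₀, r₁, r₂, rfl⟩ := eq_coords b r
      have := Submodule.add_mem _ (Submodule.add_mem _ (Submodule.add_mem _
        (Submodule.smul_mem _ (p₀ * (q₁ * r₀ - r₁ * q₀)) (hwi 0))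
        (Submodule.smul_mem _ (-(q₀ * r₁ * p₀)) (hwi 1)))
        (Submodule.smul_mem _ (-(q₀ * r₁ * p₁)) (hwi 2)))
        (Submodule.smul_mem _ (p₀ * q₁ * r₂ - p₀ * r₁ * q₂ - q₀ * r₁ * p₂) (hwi 3))
      convert this using 1
      simp [hb, w]
      module
    · obtain ⟨v₀, v₁, v₂, rfl⟩ := eq_coords b v
      replace h : v₀ ≠ 0 ∨ v₁ ≠ 0 := by simpa [Finsupp.single_apply] using h
      have hr (p q : L) := boundary_mem_relBoundaries (N := N) (x := p) (z := q) (Or.inr (Or.inl hv))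
      have hl (p q : L) := boundary_mem_relBoundaries (N := N) (x := p) (y := q) (Or.inr (Or.inr hv))
      -- It is not known which of `v₀`, `v₁` is nonzero, so each generator is reached both `v₀`
      -- times and `v₁` times.
      have hdiv {t : Chains F L 2} (h₀ : v₀ • t ∈ relBoundaries N) (h₁ : v₁ • t ∈ relBoundaries N) :
          t ∈ relBoundaries N :=
        h.elim (fun h => (Submodule.smul_mem_iff _ h).1 h₀)
          (fun h => (Submodule.smul_mem_iff _ h).1 h₁)
      have hzz' := Submodule.smul_mem _ v₂ hzz
      rintro _ ⟨i, rfl⟩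
      fin_cases i
      · apply hdiv
        · convert sub_mem (hl (b 0) (b 1)) hzz' using 1
          simp [hb, w]
          module
        · convert hr (b 0) (b 0) using 1
          simp [hb, w]
      · apply hdiv
        -- The first two terms of `∂(p ⊗ q ⊗ r)` together are antisymmetric in `q, r`; adding the
        -- transposed chain leaves `-p ⊗ ([q, r] + [r, q])`.
        · convert neg_mem (add_mem (hl (b 0) (b 1)) (hr (b 0) (b 1))) using 1
          simp [hb, w]
        · convert neg_mem (add_mem (hr (b 0) (b 0)) (hl (b 0) (b 0))) using 1
          simp [hb, w]
      · apply hdiv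
        · convert neg_mem (hr (b 1) (b 1)) using 1
          simp [hb, w]
        · convert neg_mem (hl (b 1) (b 0)) using 1
          simp [hb, w]
      · exact hzz
  rw [hS, finrank_span_eq_card hw, Fintype.card_fin]

/-- Write `[p, q] = ω(p, q) z`. Three vectors in the plane `L/Fz` satisfy `ω(p,q) r - ω(p,r) q +
ω(q,r) p = 0`, so `∂(p ⊗ q ⊗ r)` is `-ω(q,r) (z ⊗ p + p ⊗ z)` modulo `z ⊗ z`: only symmetric tensors
appear. -/
theorem finrank_relBoundaries_of_H₁
    (hb : ∀ u v : L, bracket (F := F) u v =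
      (b.repr u 0 * b.repr v 1 - b.repr u 1 * b.repr v 0) • b 2)
    {N : LeibnizIdeal F L} {v : L} (hv : v ∈ N.toSubmodule)
    (h : b.repr v 0 ≠ 0 ∨ b.repr v 1 ≠ 0) : finrank F (relBoundaries N) = 3 := by
  have hb' := isStandardBasis_of_H₁ hb
  have hzz := hb'.pair_z_z_mem (hb'.z_mem hv h)
  let w : Fin 3 → Chains F L 2 :=
    ![pair F (b 2) (b 0) + pair F (b 0) (b 2), pair F (b 2) (b 1) + pair F (b 1) (b 2),
      pair F (b 2) (b 2)]
  have hw : LinearIndependent F w := by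
    rw [Fintype.linearIndependent_iff]
    intro g hg
    have key (i j : Fin 3) := congrArg (pairForm (b.coord i) (b.coord j)) hg
    simp [w, Fin.sum_univ_three, pairForm_pair, Finsupp.single_apply] at key
    have h₀ := key 2 0
    have h₁ := key 2 1
    have h₂ := key 2 2
    simp at h₀ h₁ h₂
    intro i
    fin_cases i <;> assumption
  have hS : relBoundaries N = Submodule.span F (Set.range w) := by
    have hwi (i : Fin 3) : w i ∈ Submodule.span F (Set.range w) :=
      Submodule.subset_span ⟨i, rfl⟩
    refine le_antisymm (relBoundaries_le_of_forall fun p q r _ => ?_) (Submodule.span_le.2 ?_)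
    · obtain ⟨p₀, p₁, p₂, rfl⟩ := eq_coords b p
      obtain ⟨q₀, q₁, q₂, rfl⟩ := eq_coords b q
      obtain ⟨r₀, r₁, r₂, rfl⟩ := eq_coords b r
      have := Submodule.add_mem _ (Submodule.add_mem _
        (Submodule.smul_mem _ (-((q₀ * r₁ - q₁ * r₀) * p₀)) (hwi 0))
        (Submodule.smul_mem _ (-((q₀ * r₁ - q₁ * r₀) * p₁)) (hwi 1)))
        (Submodule.smul_mem _ ((p₀ * q₁ - p₁ * q₀) * r₂ - (p₀ * r₁ - p₁ * r₀) * q₂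
          - (q₀ * r₁ - q₁ * r₀) * p₂) (hwi 2))
      convert this using 1
      simp [hb, w]
      module
    · obtain ⟨v₀, v₁, v₂, rfl⟩ := eq_coords b v
      replace h : v₀ ≠ 0 ∨ v₁ ≠ 0 := by simpa [Finsupp.single_apply] using h
      have hr (p q : L) := boundary_mem_relBoundaries (N := N) (x := p) (z := q) (Or.inr (Or.inl hv))
      have hl (p q : L) := boundary_mem_relBoundaries (N := N) (x := p) (y := q) (Or.inr (Or.inr hv))
      have hdiv {t : Chains F L 2} (h₀ : v₀ • t ∈ relBoundaries N) (h₁ : v₁ • t ∈ relBoundaries N) :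
          t ∈ relBoundaries N :=
        h.elim (fun h => (Submodule.smul_mem_iff _ h).1 h₀)
          (fun h => (Submodule.smul_mem_iff _ h).1 h₁)
      have hzz' := Submodule.smul_mem _ v₂ hzz
      rintro _ ⟨i, rfl⟩
      fin_cases i
      · apply hdiv
        -- `∂(x ⊗ v ⊗ y) = -v₀ (z ⊗ x + x ⊗ z) - v₂ z ⊗ z`, the `z ⊗ y` terms cancelling.
        · convert sub_mem (neg_mem (hr (b 0) (b 1))) hzz' using 1
          simp [hb, w]
          module
        · convert hr (b 0) (b 0) using 1
          simp [hb, w]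
      · apply hdiv
        · convert neg_mem (hr (b 1) (b 1)) using 1
          simp [hb, w]
          module
        · convert sub_mem (hr (b 1) (b 0)) hzz' using 1
          simp [hb, w]
          module
      · exact hzz
  rw [hS, finrank_span_eq_card hw, Fintype.card_fin]

end ThreeDimensional

/-! ### `J₂` and `H₁` in coordinates -/

section Examples

variable (F : Type*) [Field F]

/-- The basis `x, y, z` of `J₂`. -/
noncomputable def basisJ₂ : Basis (Fin 3) F (J₂ F) := Pi.basisFun F (Fin 3)

/-- The basis `x, y, z` of `H₁`. -/
noncomputable def basisH₁ : Basis (Fin 3) F (H₁ F) := Pi.basisFun F (Fin 3)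

variable {F}

theorem vec_eq_smul_single (c : F) : (![0, 0, c] : Fin 3 → F) = c • Pi.single 2 1 := by
  ext i
  fin_cases i <;> simp

theorem bracket_J₂ (u v : J₂ F) : bracket (F := F) u v =
    ((basisJ₂ F).repr u 0 * (basisJ₂ F).repr v 1) • basisJ₂ F 2 := by
  have h : (basisJ₂ F 2 : Fin 3 → F) = Pi.single 2 1 := Pi.basisFun_apply F (Fin 3) 2
  change (![0, 0, u 0 * v 1] : Fin 3 → F) = (u 0 * v 1) • (basisJ₂ F 2 : Fin 3 → F)
  rw [h]
  exact vec_eq_smul_single _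

theorem bracket_H₁ (u v : H₁ F) : bracket (F := F) u v =
    ((basisH₁ F).repr u 0 * (basisH₁ F).repr v 1 - (basisH₁ F).repr u 1 * (basisH₁ F).repr v 0) •
      basisH₁ F 2 := by
  have h : (basisH₁ F 2 : Fin 3 → F) = Pi.single 2 1 := Pi.basisFun_apply F (Fin 3) 2
  change (![0, 0, u 0 * v 1 - u 1 * v 0] : Fin 3 → F) =
    (u 0 * v 1 - u 1 * v 0) • (basisH₁ F 2 : Fin 3 → F)
  rw [h]
  exact vec_eq_smul_single _

theorem finrank_HL₂_J₂ (N : LeibnizIdeal F (J₂ F)) (hN : N.toSubmodule ≠ ⊥) :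
    (finrank F N.toSubmodule = 2 → finrank F (HL₂ N) = 3) ∧
      (finrank F N.toSubmodule ≠ 2 → finrank F (HL₂ N) = 4) := by
  have hb := isStandardBasis_of_J₂ (bracket_J₂ (F := F))
  rcases eq_span_or_exists_coord_ne_zero (basisJ₂ F) hN with h | ⟨v, hv, h⟩
  · refine ⟨fun h2 => ?_, fun _ => hb.finrank_HL₂_of_eq_span h⟩
    rw [h, finrank_span_singleton ((basisJ₂ F).ne_zero 2)] at h2
    omega
  · have h₁ := hb.finrank_HL₂_add_relBoundaries hv h
    rw [finrank_relBoundaries_of_J₂ bracket_J₂ hv h] at h₁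
    -- `9 - 1 - 4 - (3 - d)²` is 3 for `d = 2` and 4 for `d = 3`.
    rcases hb.finrank_eq_two_or_three hv h with h₂ | h₂ <;> rw [h₂] at h₁ ⊢ <;> omega

theorem finrank_HL₂_H₁ (N : LeibnizIdeal F (H₁ F)) (hN : N.toSubmodule ≠ ⊥) :
    (N.toSubmodule = ⊤ → finrank F (HL₂ N) = 5) ∧
      (N.toSubmodule ≠ ⊤ → finrank F (HL₂ N) = 4) := by
  have hb := isStandardBasis_of_H₁ (bracket_H₁ (F := F))
  have : FiniteDimensional F (H₁ F) := (basisH₁ F).finiteDimensional_of_finite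
  have h3 : finrank F (H₁ F) = 3 := by rw [finrank_eq_card_basis (basisH₁ F), Fintype.card_fin]
  have htop : N.toSubmodule = ⊤ ↔ finrank F N.toSubmodule = 3 :=
    ⟨fun h => by rw [h, finrank_top, h3], fun h => Submodule.eq_top_of_finrank_eq (by rw [h, h3])⟩
  rw [Ne, htop]
  rcases eq_span_or_exists_coord_ne_zero (basisH₁ F) hN with h | ⟨v, hv, h⟩
  · refine ⟨fun h2 => ?_, fun _ => hb.finrank_HL₂_of_eq_span h⟩
    rw [h, finrank_span_singleton ((basisH₁ F).ne_zero 2)] at h2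
    omega
  · have h₁ := hb.finrank_HL₂_add_relBoundaries hv h
    rw [finrank_relBoundaries_of_H₁ bracket_H₁ hv h] at h₁
    -- `9 - 1 - 3 - (3 - d)²` is 4 for `d = 2` and 5 for `d = 3`.
    rcases hb.finrank_eq_two_or_three hv h with h₂ | h₂ <;> rw [h₂] at h₁ ⊢ <;> omega

end Examples

end LeibnizAlgebra

theorem corollary3p5 {F : Type*} [Field F] :
    -- (i) ideals of an abelian algebra of dimension `q`
    (∀ (A : Type*) [AddCommGroup A] [Module F A] [LeibnizAlgebra F A] [FiniteDimensional F A]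
        (q n : ℕ), LeibnizAlgebra.IsAbelian F A → Module.finrank F A = q →
        ∀ N : LeibnizIdeal F A, Module.finrank F N.toSubmodule = n →
          (Module.finrank F (LeibnizAlgebra.HL₂ N) : ℤ) = n * (2 * q - n)) ∧
    -- (ii) nilpotent algebras with one-dimensional derived ideal
    (∀ (G : Type*) [AddCommGroup G] [Module F G] [LeibnizAlgebra F G] [FiniteDimensional F G],
        LeibnizAlgebra.IsNilpotent F G →
        Module.finrank F (LeibnizAlgebra.derivedIdeal F G).toSubmodule = 1 →
          Module.finrank F (LeibnizAlgebra.HL₂ (LeibnizAlgebra.derivedIdeal F G)) =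
            2 * Module.finrank F (LeibnizAlgebra.derivedIdeal F G).Quotient) ∧
    -- (iii) non-zero ideals of `J₂` and `H₁`
    (∀ N : LeibnizIdeal F (J₂ F), N.toSubmodule ≠ ⊥ →
        (Module.finrank F N.toSubmodule = 2 → Module.finrank F (LeibnizAlgebra.HL₂ N) = 3) ∧
        (Module.finrank F N.toSubmodule ≠ 2 → Module.finrank F (LeibnizAlgebra.HL₂ N) = 4)) ∧
    (∀ N : LeibnizIdeal F (H₁ F), N.toSubmodule ≠ ⊥ →
        (N.toSubmodule = ⊤ → Module.finrank F (LeibnizAlgebra.HL₂ N) = 5) ∧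
        (N.toSubmodule ≠ ⊤ → Module.finrank F (LeibnizAlgebra.HL₂ N) = 4)) := by
  refine ⟨fun A _ _ _ _ q n hA hq N hn => ?_, fun G _ _ _ _ hG h1 =>
    LeibnizAlgebra.finrank_HL₂_derivedIdeal hG h1, LeibnizAlgebra.finrank_HL₂_J₂,
    LeibnizAlgebra.finrank_HL₂_H₁⟩
  have h₁ := LeibnizAlgebra.finrank_HL₂_of_isAbelian hA N
  have h₂ := LeibnizAlgebra.finrank_quotient_add N
  rw [hn, hq] at h₂
  -- With `q = m + n` and `m = dim A/N`, the claim is `(m + n)² - m² = n(2(m + n) - n)`.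
  rw [hq, ← h₂] at h₁
  rw [← h₂]
  zify at h₁
  push_cast
  linarith
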